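/- Let $X\subseteq\mathbb{Z}^m$ and $Y\subseteq\mathbb{Z}^n$ carry the $c_1$-adjacency: two distinct points are adjacent if they differ in exactly one coordinate, and there by $1$. A function between such sets is *continuous* if it sends adjacent points to adjacent or equal points. Functions $f,g:X\to Y$ are *digitally homotopic* if they are continuous and there are an integer $k\ge 1$ and $H:X\times\{0,\dots,k\}\to Y$ with $H(\cdot,0)=f$ and $H(\cdot,k)=g$, such that every $H(\cdot,t)$ is continuous and, for every $x\in X$ and $0\le t<k$, the points $H(x,t)$ and $H(x,t+1)$ are adjacent or equal. An *elementary $q$-cube* in $X$ is a set $Q=J_1\times\dots\times J_m\subseteq X$ in which $q$ of the factors, those with indices $j_1<\dots<j_q$, are of the form $\{a,a+1\}$, and the other factors are single points. Let $\bar C^{c_1}_q(X)$ be the free abelian group on the elementary $q$-cubes in $X$. Put $\partial_0=0$ and, for $q\ge1$, $\partial_q Q=\sum_{i=1}^q(-1)^i(A_{j_i}Q-B_{j_i}Q)$, where $A_jQ$ and $B_jQ$ arise from $Q$ by replacing $J_j$ by $\{\min J_j\}$ and $\{\max J_j\}$, respectively. Let $\bar H^{c_1}_q(X)=\ker\partial_q/\operatorname{im}\partial_{q+1}$.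 For a function $f:X\to Y$ let $\bar f_\#:\bar C^{c_1}_q(X)\to\bar C^{c_1}_q(Y)$ be the homomorphism with $\bar f_\#(Q)=\epsilon_{f,Q}\,f(Q)$ if $f(Q)$ is an elementary $q$-cube in $Y$, and $\bar f_\#(Q)=0$ otherwise. Here $\epsilon_{f,Q}$ is the orientation of $f|_Q:Q\to f(Q)$: the determinant of the matrix whose $l$-th column consists of the coordinates of $f(v+e_{j_l})-f(v)$ in the nondegenerate directions of $f(Q)$, in increasing order, where $v$ is the vertex of $Q$ with the smallest coordinates. If $\bar f_\#$ is a chain map, let $\bar f_*:\bar H^{c_1}_q(X)\to\bar H^{c_1}_q(Y)$ be the homomorphisms that it induces. **Theorem.** Let $f,g:X\to Y$ be digitally homotopic. (1) If $m\le 3$, then $\bar f_\#$ and $\bar g_\#$ are chain maps, and $\bar f_*=\bar g_*:\bar H^{c_1}_q(X)\to\bar H^{c_1}_q(Y)$ for every $q\ge 0$. (2) If, for all $m',n'$, all $X'\subseteq\mathbb{Z}^{m'}$ and $Y'\subseteq\mathbb{Z}^{n'}$ with $c_1$-adjacency and all continuous $h:X'\to Y'$, the map $\bar h_\#$ is a chain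 map, then the conclusion of (1) holds for every $m$. -/

import Mathlib

namespace DigitalImage

/-! ### Digital images, continuity, homotopy

A digital image is a set with a symmetric and antireflexive adjacency relation,
that is, a simple graph. -/

/-- The adjacency `c_k` on `ℤ^n`: distinct points whose coordinates differ by at most `1` in at
most `k` positions and are equal in all other positions. -/
def cGraph (n k : ℕ) : SimpleGraph (Fin n → ℤ) where
  Adj x y := x ≠ y ∧ (∀ i, |x i - y i| ≤ 1) ∧ (Finset.univ.filter fun i => x i ≠ y i).card ≤ k
  symm := ⟨fun x y h => ⟨h.1.symm, fun i => by rw [abs_sub_comm]; exact h.2.1 i, by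
    simpa only [ne_comm] using h.2.2⟩⟩
  loopless := ⟨fun _ h => h.1 rfl⟩

/-- A subset of `ℤ^n` as a digital image with `c_1`-adjacency. -/
abbrev c1Image {n : ℕ} (X : Set (Fin n → ℤ)) : SimpleGraph X :=
  (cGraph n 1).induce X

/-- The digital interval `[0,k]_ℤ` with its standard adjacency: `a` and `b` are adjacent iff
`|a - b| = 1`. -/
def intervalGraph (k : ℕ) : SimpleGraph (Set.Icc (0 : ℤ) k) where
  Adj a b := |(a : ℤ) - b| = 1
  symm := ⟨fun a b h => by rw [abs_sub_comm]; exact h⟩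
  loopless := ⟨fun a h => by simp at h⟩

/-- Digital continuity: adjacent points are sent to adjacent or equal points. -/
def IsContinuous {V W : Type*} (G : SimpleGraph V) (K : SimpleGraph W) (f : V → W) : Prop :=
  ∀ ⦃x y : V⦄, G.Adj x y → K.Adj (f x) (f y) ∨ f x = f y

/-- Digital homotopy of (continuous) functions between digital images. -/
def Homotopic {V W : Type*} (G : SimpleGraph V) (K : SimpleGraph W) (f g : V → W) : Prop :=
  IsContinuous G K f ∧ IsContinuous G K g ∧
    ∃ (k : ℕ) (_ : 0 < k) (H : V → Set.Icc (0 : ℤ) k → W),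
      (∀ x, H x ⟨0, by simp⟩ = f x ∧ H x ⟨k, by simp⟩ = g x) ∧
      (∀ x, IsContinuous (intervalGraph k) K (H x)) ∧
      (∀ t, IsContinuous G K fun x => H x t)

/-! ### Elementary cubes -/

/-- An elementary cube `J_1 × ⋯ × J_n` in `ℤ^n`. It is recorded by the left end points
`low i = min J_i` and by the set `dirs` of the indices `i` for which `J_i` is nondegenerate:
`J_i = {low i, low i + 1}` for `i ∈ dirs`, and `J_i = {low i}` otherwise. -/
@[ext]
structure ElementaryCube (n : ℕ) where
  low : Fin n → ℤ
  dirs : Finset (Fin n)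

namespace ElementaryCube

variable {n : ℕ}

/-- `max J_i`. -/
def high (Q : ElementaryCube n) (i : Fin n) : ℤ :=
  if i ∈ Q.dirs then Q.low i + 1 else Q.low i

/-- The elementary cube as a set of points of `ℤ^n`. -/
def toSet (Q : ElementaryCube n) : Set (Fin n → ℤ) :=
  Set.univ.pi fun i => Set.Icc (Q.low i) (Q.high i)

/-- The front face `A_i Q`, in which `J_i` is replaced by `{min J_i}`. -/
def faceA (Q : ElementaryCube n) (i : Fin n) : ElementaryCube n :=
  ⟨Q.low, Q.dirs.erase i⟩

/-- The back face `B_i Q`, in which `J_i` is replaced by `{max J_i}`. -/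
def faceB (Q : ElementaryCube n) (i : Fin n) : ElementaryCube n :=
  ⟨Function.update Q.low i (Q.high i), Q.dirs.erase i⟩

theorem low_le_high (Q : ElementaryCube n) (i : Fin n) : Q.low i ≤ Q.high i := by
  unfold high; split_ifs <;> omega

theorem low_mem (Q : ElementaryCube n) : Q.low ∈ Q.toSet :=
  fun i _ => ⟨le_rfl, Q.low_le_high i⟩

theorem high_mem (Q : ElementaryCube n) : Q.high ∈ Q.toSet :=
  fun i _ => ⟨Q.low_le_high i, le_rfl⟩

/-- An elementary cube is determined by its set of points. -/
theorem toSet_injective : Function.Injective (toSet : ElementaryCube n → Set (Fin n → ℤ)) := by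
  intro Q R h
  have h1 : Q.low ∈ R.toSet := h ▸ Q.low_mem
  have h2 : R.low ∈ Q.toSet := h ▸ R.low_mem
  have h3 : Q.high ∈ R.toSet := h ▸ Q.high_mem
  have h4 : R.high ∈ Q.toSet := h ▸ R.high_mem
  have hl : ∀ i, Q.low i = R.low i := fun i =>
    le_antisymm (h2 i trivial).1 (h1 i trivial).1
  have hh : ∀ i, Q.high i = R.high i := fun i =>
    le_antisymm (h3 i trivial).2 (h4 i trivial).2
  ext i
  · exact hl i
  · have a := hl i
    have b := hh i
    unfold high at b
    split_ifs at b <;> first | omega | simp_all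

theorem faceA_subset (Q : ElementaryCube n) (i : Fin n) : (Q.faceA i).toSet ⊆ Q.toSet := by
  intro x hx j _
  have := hx j trivial
  simp only [faceA, high, Finset.mem_erase, Set.mem_Icc] at this ⊢
  split_ifs at this ⊢ <;> first | omega | simp_all

theorem faceB_subset (Q : ElementaryCube n) (i : Fin n) : (Q.faceB i).toSet ⊆ Q.toSet := by
  intro x hx j _
  have := hx j trivial
  by_cases hji : j = i
  · subst hji
    simp only [faceB, high, Finset.mem_erase, Set.mem_Icc, Function.update_self] at this ⊢
    split_ifs at this ⊢ <;> omega
  · simp only [faceB, high, Finset.mem_erase, Set.mem_Icc, Function.update_of_ne hji] at this ⊢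
    split_ifs at this ⊢ <;> first | omega | simp_all

end ElementaryCube

/-- The elementary `q`-cubes contained in `X ⊆ ℤ^n`. -/
@[ext]
structure CubeIn {n : ℕ} (X : Set (Fin n → ℤ)) (q : ℕ) extends ElementaryCube n where
  card_dirs : dirs.card = q
  subset : toElementaryCube.toSet ⊆ X

namespace CubeIn

variable {n q : ℕ} {X : Set (Fin n → ℤ)}

/-- The nondegenerate indices `j_1 < ⋯ < j_q` of an elementary `q`-cube (numbered from `0`). -/
def dir (Q : CubeIn X q) : Fin q ↪o Fin n :=
  Q.dirs.orderEmbOfFin Q.card_dirs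

theorem dir_mem (Q : CubeIn X q) (i : Fin q) : Q.dir i ∈ Q.dirs :=
  Finset.orderEmbOfFin_mem _ _ i

/-- The front face with respect to the `i`-th nondegenerate index. -/
def faceA (Q : CubeIn X (q + 1)) (i : Fin (q + 1)) : CubeIn X q where
  toElementaryCube := Q.toElementaryCube.faceA (Q.dir i)
  card_dirs := by
    simp [ElementaryCube.faceA, Finset.card_erase_of_mem (Q.dir_mem i), Q.card_dirs]
  subset := (ElementaryCube.faceA_subset _ _).trans Q.subset

/-- The back face with respect to the `i`-th nondegenerate index. -/
def faceB (Q : CubeIn X (q + 1)) (i : Fin (q + 1)) : CubeIn X q where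
  toElementaryCube := Q.toElementaryCube.faceB (Q.dir i)
  card_dirs := by
    simp [ElementaryCube.faceB, Finset.card_erase_of_mem (Q.dir_mem i), Q.card_dirs]
  subset := (ElementaryCube.faceB_subset _ _).trans Q.subset

theorem dir_eq_of (Q : CubeIn X (q+1)) (i : Fin (q+1)) (R : CubeIn X q)
    (h : R.dirs = Q.dirs.erase (Q.dir i)) (j : Fin q) : R.dir j = Q.dir (i.succAbove j) := by
  have : (fun j => Q.dir (i.succAbove j)) = R.dirs.orderEmbOfFin R.card_dirs := by
    apply Finset.orderEmbOfFin_unique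
    · intro x
      rw [h, Finset.mem_erase]
      exact ⟨fun e => Fin.succAbove_ne i x (Q.dir.injective e), Q.dir_mem _⟩
    · exact Q.dir.strictMono.comp (Fin.strictMono_succAbove i)
  exact (congrFun this j).symm

/-- The vertex of `Q` with the smallest coordinates, as a point of `X`. -/
def corner (Q : CubeIn X q) : X :=
  ⟨Q.low, Q.subset Q.low_mem⟩

/-- The vertex of `Q` next to `Q.corner` in the `i`-th nondegenerate direction. -/
def neighbor (Q : CubeIn X q) (i : Fin q) : X :=
  ⟨Function.update Q.low (Q.dir i) (Q.low (Q.dir i) + 1), Q.subset fun j _ => by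
    by_cases hj : j = Q.dir i
    · subst hj
      simp [ElementaryCube.high, Q.dir_mem i]
    · simpa [Function.update_of_ne hj] using Q.low_le_high j⟩

end CubeIn

/-! ### The `c_1`-cubical chain complex and its homology -/

/-- The chain group: the free abelian group on the elementary `q`-cubes in `X`. -/
abbrev Chain {n : ℕ} (X : Set (Fin n → ℤ)) (q : ℕ) : Type :=
  CubeIn X q →₀ ℤ

section Homology

variable {n : ℕ} (X : Set (Fin n → ℤ))

/-- The boundary operator `∂_{q+1}`, with
`∂ Q = ∑_{i = 1}^{q+1} (-1)^i (A_{j_i} Q - B_{j_i} Q)`. -/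
noncomputable def boundary (q : ℕ) : Chain X (q + 1) →ₗ[ℤ] Chain X q :=
  Finsupp.linearCombination ℤ fun Q =>
    ∑ i : Fin (q + 1), (-1 : ℤ) ^ ((i : ℕ) + 1) •
      (Finsupp.single (Q.faceA i) (1 : ℤ) - Finsupp.single (Q.faceB i) (1 : ℤ))

/-- The composite of two successive boundary operators vanishes. -/
theorem boundary_boundary (q : ℕ) : boundary X q ∘ₗ boundary X (q + 1) = 0 := by
  refine Finsupp.lhom_ext' fun Q => LinearMap.ext_ring ?_
  have hA : ∀ i j, (Q.faceA i).dir j = Q.dir (i.succAbove j) := fun i j =>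
    CubeIn.dir_eq_of Q i _ rfl j
  have hB : ∀ i j, (Q.faceB i).dir j = Q.dir (i.succAbove j) := fun i j =>
    CubeIn.dir_eq_of Q i _ rfl j
  have hne : ∀ (i : Fin (q+2)) (j : Fin (q+1)), Q.dir (i.succAbove j) ≠ Q.dir i := fun i j e =>
    Fin.succAbove_ne i j (Q.dir.injective e)
  have hAA : ∀ i j, (Q.faceA (i.succAbove j)).faceA (j.predAbove i) = (Q.faceA i).faceA j := by
    intro i j
    ext1
    · rfl
    · change (Q.dirs.erase _).erase _ = (Q.dirs.erase _).erase _
      rw [hA, hA, Fin.succAbove_succAbove_predAbove, Finset.erase_right_comm]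
  have hBB : ∀ i j, (Q.faceB (i.succAbove j)).faceB (j.predAbove i) = (Q.faceB i).faceB j := by
    intro i j
    ext1
    · change Function.update (Function.update _ _ _) _ _ = Function.update (Function.update _ _ _) _ _
      rw [hB, hB, Fin.succAbove_succAbove_predAbove, Function.update_comm (hne i j)]
      simp [CubeIn.faceB, ElementaryCube.faceB, ElementaryCube.high, hne, (hne _ _).symm]
    · change (Q.dirs.erase _).erase _ = (Q.dirs.erase _).erase _
      rw [hB, hB, Fin.succAbove_succAbove_predAbove, Finset.erase_right_comm]
  have hAB : ∀ i j, (Q.faceA (i.succAbove j)).faceB (j.predAbove i) = (Q.faceB i).faceA j := by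
    intro i j
    ext1
    · change Function.update _ _ _ = Function.update _ _ _
      rw [hA, Fin.succAbove_succAbove_predAbove]
      simp [CubeIn.faceA, ElementaryCube.faceA, ElementaryCube.high, (hne _ _).symm]
    · change (Q.dirs.erase _).erase _ = (Q.dirs.erase _).erase _
      rw [hA, hB, Fin.succAbove_succAbove_predAbove, Finset.erase_right_comm]
  have hBA : ∀ i j, (Q.faceB (i.succAbove j)).faceA (j.predAbove i) = (Q.faceA i).faceB j := by
    intro i j
    have := hAB (i.succAbove j) (j.predAbove i)
    rw [Fin.succAbove_succAbove_predAbove, Fin.predAbove_predAbove_succAbove] at this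
    exact this.symm
  simp only [LinearMap.comp_apply, Finsupp.lsingle_apply, LinearMap.zero_apply, boundary,
    Finsupp.linearCombination_single, map_sum, map_smul, map_sub, Finset.smul_sum,
    ← Finset.sum_sub_distrib, ← smul_sub, smul_smul]
  rw [← Finset.sum_product', Finset.univ_product_univ]
  refine Finset.sum_involution (fun p _ => (p.1.succAbove p.2, p.2.predAbove p.1)) ?_ ?_ ?_ ?_
  · rintro ⟨i, j⟩ -
    have hs := Fin.neg_one_pow_succAbove_add_predAbove (R := ℤ) i j
    simp only [hAA, hBB, hAB, hBA]
    simp only [pow_add] at hs ⊢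
    have h1 : ∀ a b : ℤ, 1 * (a * (-1) ^ 1) * (1 * (b * (-1) ^ 1)) = a * b := fun a b => by ring
    rw [h1, h1, hs]
    module
  · rintro ⟨i, j⟩ - - h
    exact Fin.succAbove_ne i j (congrArg Prod.fst h)
  · intros
    exact Finset.mem_univ _
  · rintro ⟨i, j⟩ -
    exact Prod.ext (Fin.succAbove_succAbove_predAbove i j) (Fin.predAbove_predAbove_succAbove i j)
/-- The cycles `Z_q = ker ∂_q` (where `∂_0 = 0`). -/
noncomputable def cycles : (q : ℕ) → Submodule ℤ (Chain X q)
  | 0 => ⊤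
  | q + 1 => LinearMap.ker (boundary X q)

/-- The boundaries `B_q = im ∂_{q+1}`. -/
noncomputable def boundaries (q : ℕ) : Submodule ℤ (Chain X q) :=
  LinearMap.range (boundary X q)

/-- The `c_1`-cubical homology group `H_q = Z_q / B_q`. -/
abbrev Homology (q : ℕ) : Type :=
  cycles X q ⧸ (boundaries X q).submoduleOf (cycles X q)

end Homology

/-! ### The induced homomorphism -/

section Induced

variable {m n : ℕ} {X : Set (Fin m → ℤ)} {Y : Set (Fin n → ℤ)}

/-- The image `f(Q)` of an elementary cube `Q` in `X`, as a set of points of `ℤ^n`. -/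
def imageSet (f : X → Y) {q : ℕ} (Q : CubeIn X q) : Set (Fin n → ℤ) :=
  {y | ∃ x : X, (x : Fin m → ℤ) ∈ Q.toSet ∧ (f x : Fin n → ℤ) = y}

/-- The orientation with which `f` maps the elementary `q`-cube `Q` onto the elementary `q`-cube
`R = f(Q)`: the determinant of the linear part of the affine map `Q → R`, both cubes being
identified with `[0,1]^q` through their nondegenerate coordinates in increasing order. -/
def orientation (f : X → Y) {q : ℕ} (Q : CubeIn X q) (R : CubeIn Y q) : ℤ :=
  (Matrix.of fun i j : Fin q =>
    (f (Q.neighbor j) : Fin n → ℤ) (R.dir i) - (f Q.corner : Fin n → ℤ) (R.dir i)).det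

open Classical in
/-- The chain `f_#(Q)`: it is `ε • f(Q)` if `f(Q)` is an elementary `q`-cube in `Y`, where `ε` is
the orientation of `f` on `Q`, and `0` otherwise. -/
noncomputable def pushCube (f : X → Y) {q : ℕ} (Q : CubeIn X q) : Chain Y q :=
  if h : ∃ R : CubeIn Y q, imageSet f Q = R.toSet then
    orientation f Q h.choose • Finsupp.single h.choose (1 : ℤ)
  else 0

/-- The homomorphism `f_#` of chain groups. -/
noncomputable def pushChain (f : X → Y) (q : ℕ) : Chain X q →ₗ[ℤ] Chain Y q :=
  Finsupp.linearCombination ℤ (pushCube f)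

/-- `f_#` commutes with the boundary operators (in degree `0` there is nothing to say). -/
def IsChainMap (f : X → Y) : Prop :=
  ∀ q : ℕ, pushChain f q ∘ₗ boundary X q = boundary Y q ∘ₗ pushChain f (q + 1)

theorem IsChainMap.map_cycles {f : X → Y} (hf : IsChainMap f) (q : ℕ) :
    ∀ z ∈ cycles X q, pushChain f q z ∈ cycles Y q := by
  intro z hz
  cases q with
  | zero => trivial
  | succ q =>
    have hz' : boundary X q z = 0 := hz
    change boundary Y q (pushChain f (q + 1) z) = 0
    rw [← LinearMap.comp_apply, ← hf q, LinearMap.comp_apply, hz', map_zero]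

/-- The homomorphism `f_* : H_q(X) → H_q(Y)` induced by the chain map `f_#`. -/
noncomputable def inducedMap (f : X → Y) (hf : IsChainMap f) (q : ℕ) :
    Homology X q →ₗ[ℤ] Homology Y q :=
  Submodule.mapQ _ _ ((pushChain f q).restrict (hf.map_cycles q)) (by
    rintro ⟨z, hz⟩ ⟨w, hw⟩
    exact ⟨pushChain f (q + 1) w, by
      rw [← LinearMap.comp_apply, ← hf q, LinearMap.comp_apply, hw]; rfl⟩)

end Induced

/-- The conjecture that every continuous map between images with `c_1`-adjacency, in any
dimensions, induces a chain map. -/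
def ChainMapConjecture : Prop :=
  ∀ (m n : ℕ) (X : Set (Fin m → ℤ)) (Y : Set (Fin n → ℤ)) (f : X → Y),
    IsContinuous (c1Image X) (c1Image Y) f → IsChainMap f

end DigitalImage

/-!
Every continuous map between images with `c_1`-adjacency induces a chain map, whatever the
dimensions (`IsContinuous.isChainMap`). In particular `ChainMapConjecture` holds, and both parts of
the theorem follow from the same prism argument.

Let `f` be continuous and `Q` a cube of dimension `q + 1`. If `f` is injective on `Q`, then it
sends the two-dimensional faces of `Q` to parallelograms, so it is affine on `Q`: a signed
permutation of coordinates onto a cube `R` (`exists_isSignedPerm`). The identity `f_# ∂Q = ∂ f_# Q`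
is then the Laplace expansion of the determinant that defines the orientation, along the column of
each direction of `Q` (`IsSignedPerm.map_boundary`).

If `f` is not injective on `Q`, then `f_# Q = 0`, and `f_# ∂Q = 0` has to be shown. By induction on
the dimension, `f_# ∂Q` is a `q`-cycle, and its vertices lie in `f(Q)`, which has fewer than
`2 ^ (q + 1)` points. But a nonzero `q`-cycle in `ℤ^n` has at least `2 ^ (q + 1)` vertices
(`IsReducedCycle.two_pow_le`): its slice by a slab orthogonal to one of the coordinate directions
is a nonzero `(q - 1)`-cycle whose vertices occur on both sides of the slab.

A step of a homotopy from `f` to `g` is a continuous map `F` on the cylinder `{0, 1} × X`. As `F`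
induces a chain map, the prism operator shows that `g_# z - f_# z = ∂ F_# (prism z)` for every
cycle `z` (`sub_mem_boundaries_of_step`).
-/

namespace DigitalImage

/-! ### Adjacent points and vertices of cubes -/

theorem cGraph_one_adj_iff {n : ℕ} {x y : Fin n → ℤ} :
    (cGraph n 1).Adj x y ↔ ∃ k, ∃ e : ℤ, (e = 1 ∨ e = -1) ∧ y = x + Pi.single k e := by
  constructor
  · rintro ⟨hne, hle, hcard⟩
    obtain ⟨k, hk⟩ := Function.ne_iff.mp hne
    have h1 := abs_le.mp (hle k)
    refine ⟨k, y k - x k, by omega, ?_⟩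
    ext i
    by_cases hi : i = k
    · subst hi; simp
    · have : x i = y i := by
        by_contra h
        exact hi (Finset.card_le_one.mp hcard i (by simpa using h) k (by simpa using hk))
      simp [Pi.single_eq_of_ne hi, this]
  · rintro ⟨k, e, he, rfl⟩
    refine ⟨fun h => ?_, fun i => ?_, ?_⟩
    · have := congrFun h k
      simp at this
      omega
    · by_cases hi : i = k
      · subst hi; rcases he with rfl | rfl <;> simp
      · simp [Pi.single_eq_of_ne hi]
    · refine Finset.card_le_one.mpr fun i hi j hj => ?_
      have : ∀ i, x i ≠ (x + Pi.single k e : Fin n → ℤ) i → i = k := fun i h => by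
        by_contra hi
        simp [Pi.single_eq_of_ne hi] at h
      rw [this i (by simpa using hi), this j (by simpa using hj)]

/-- A closed walk of length four in `ℤ^n` without backtracking is a parallelogram. -/
theorem cGraph_one_parallelogram {n : ℕ} {p a b r : Fin n → ℤ} (ha : (cGraph n 1).Adj p a)
    (hb : (cGraph n 1).Adj p b) (har : (cGraph n 1).Adj a r) (hbr : (cGraph n 1).Adj b r)
    (hab : a ≠ b) (hpr : p ≠ r) : r - a = b - p := by
  obtain ⟨i, α, hα, rfl⟩ := cGraph_one_adj_iff.mp ha
  obtain ⟨j, β, hβ, rfl⟩ := cGraph_one_adj_iff.mp hb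
  obtain ⟨k, γ, hγ, rfl⟩ := cGraph_one_adj_iff.mp har
  obtain ⟨l, δ, hδ, h⟩ := cGraph_one_adj_iff.mp hbr
  have hco : ∀ t, (if t = i then α else 0) + (if t = k then γ else 0)
      = (if t = j then β else 0) + (if t = l then δ else 0) := fun t => by
    have := congrFun h t
    simp only [Pi.add_apply, Pi.single_apply] at this
    omega
  have hpr' : ¬ (i = k ∧ α + γ = 0) := by
    rintro ⟨rfl, h0⟩
    apply hpr
    rw [add_assoc, ← Pi.single_add, h0]
    simp
  have hab' : ¬ (i = j ∧ α = β) := by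
    rintro ⟨rfl, rfl⟩
    exact hab rfl
  have key : k = j ∧ γ = β := by
    have h1 := hco i
    have h2 := hco j
    have h3 := hco k
    have h4 := hco l
    grind
  obtain ⟨rfl, rfl⟩ := key
  abel

theorem ElementaryCube.ncard_toSet {n : ℕ} (Q : ElementaryCube n) :
    Q.toSet.ncard = 2 ^ Q.dirs.card := by
  have : Q.toSet = ↑(Fintype.piFinset fun i => Finset.Icc (Q.low i) (Q.high i)) := by
    ext x; simp [toSet, Pi.le_def]
  rw [this, Set.ncard_coe_finset, Fintype.card_piFinset]
  have : ∀ i, (Finset.Icc (Q.low i) (Q.high i)).card = if i ∈ Q.dirs then 2 else 1 := fun i => by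
    rw [Int.card_Icc, high]; split_ifs <;> omega
  simp [this]

namespace CubeIn

variable {n q : ℕ} {X : Set (Fin n → ℤ)}

theorem toElementaryCube_injective :
    Function.Injective (toElementaryCube : CubeIn X q → ElementaryCube n) := by
  rintro ⟨Q, _, _⟩ ⟨R, _, _⟩ h
  cases h
  rfl

theorem ncard_toSet (Q : CubeIn X q) : Q.toSet.ncard = 2 ^ q := by
  rw [ElementaryCube.ncard_toSet, Q.card_dirs]

theorem finite_toSet (Q : CubeIn X q) : Q.toSet.Finite :=
  Set.finite_of_ncard_pos (by rw [Q.ncard_toSet]; positivity)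

/-- The vertices of `Q`, as points of `X`. -/
def vertices (Q : CubeIn X q) : Set X := {x | (x : Fin n → ℤ) ∈ Q.toSet}

theorem image_vertices (Q : CubeIn X q) : Subtype.val '' Q.vertices = Q.toSet := by
  ext x
  constructor
  · rintro ⟨y, hy, rfl⟩; exact hy
  · intro hx; exact ⟨⟨x, Q.subset hx⟩, hx, rfl⟩

theorem ncard_vertices (Q : CubeIn X q) : Q.vertices.ncard = 2 ^ q := by
  rw [← Q.ncard_toSet, ← Q.image_vertices,
    Set.ncard_image_of_injective _ Subtype.val_injective]

theorem finite_vertices (Q : CubeIn X q) : Q.vertices.Finite :=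
  Set.finite_of_ncard_pos (by rw [Q.ncard_vertices]; positivity)

theorem exists_dir_eq (Q : CubeIn X q) {i : Fin n} (hi : i ∈ Q.dirs) : ∃ j, Q.dir j = i := by
  have := Finset.range_orderEmbOfFin Q.dirs Q.card_dirs
  have hi' : i ∈ Set.range (Q.dirs.orderEmbOfFin Q.card_dirs) := this ▸ hi
  exact hi'

theorem high_dir (Q : CubeIn X q) (j : Fin q) : Q.high (Q.dir j) = Q.low (Q.dir j) + 1 := by
  simp [ElementaryCube.high, Q.dir_mem]

theorem mem_faceA_iff (Q : CubeIn X (q + 1)) (l : Fin (q + 1)) (x : Fin n → ℤ) :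
    x ∈ (Q.faceA l).toSet ↔ x ∈ Q.toSet ∧ x (Q.dir l) = Q.low (Q.dir l) := by
  constructor
  · intro h
    refine ⟨ElementaryCube.faceA_subset _ _ h, ?_⟩
    have := h (Q.dir l) trivial
    simp only [faceA, ElementaryCube.faceA, ElementaryCube.high, Finset.mem_erase, ne_eq,
      not_true_eq_false, false_and, if_false, Set.mem_Icc] at this
    omega
  · rintro ⟨h, hl⟩ i -
    have := h i trivial
    by_cases hi : i = Q.dir l
    · subst hi
      simp [faceA, ElementaryCube.faceA, ElementaryCube.high, hl]
    · simpa [faceA, ElementaryCube.faceA, ElementaryCube.high, hi] using this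

theorem mem_faceB_iff (Q : CubeIn X (q + 1)) (l : Fin (q + 1)) (x : Fin n → ℤ) :
    x ∈ (Q.faceB l).toSet ↔ x ∈ Q.toSet ∧ x (Q.dir l) = Q.low (Q.dir l) + 1 := by
  constructor
  · intro h
    refine ⟨ElementaryCube.faceB_subset _ _ h, ?_⟩
    have := h (Q.dir l) trivial
    simp [faceB, ElementaryCube.faceB, ElementaryCube.high, Q.dir_mem] at this
    omega
  · rintro ⟨h, hl⟩ i -
    have := h i trivial
    by_cases hi : i = Q.dir l
    · subst hi
      simp [faceB, ElementaryCube.faceB, ElementaryCube.high, hl, Q.dir_mem]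
    · simpa [faceB, ElementaryCube.faceB, ElementaryCube.high, hi, Function.update_of_ne hi]
        using this

/-- The vertex of `Q` lying above the smallest vertex in exactly the nondegenerate directions
numbered by `s`. -/
def vertex (Q : CubeIn X q) (s : Finset (Fin q)) : X :=
  ⟨fun i => Q.low i + if i ∈ s.map Q.dir.toEmbedding then 1 else 0, Q.subset fun i _ => by
    split_ifs with h
    · obtain ⟨j, -, rfl⟩ := Finset.mem_map.mp h
      simp [ElementaryCube.high, Q.dir_mem]
    · simpa using Q.low_le_high i⟩

theorem vertex_apply_dir (Q : CubeIn X q) (s : Finset (Fin q)) (j : Fin q) :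
    (Q.vertex s : Fin n → ℤ) (Q.dir j) = Q.low (Q.dir j) + if j ∈ s then 1 else 0 := by
  simp [vertex]

theorem vertex_mem (Q : CubeIn X q) (s : Finset (Fin q)) : Q.vertex s ∈ Q.vertices := by
  intro i _
  simp only [vertex]
  split_ifs with h
  · obtain ⟨j, -, rfl⟩ := Finset.mem_map.mp h
    simp [ElementaryCube.high, Q.dir_mem]
  · simpa using Q.low_le_high i

theorem vertex_injective (Q : CubeIn X q) : Function.Injective Q.vertex := by
  intro s t h
  ext j
  have := congrFun (congrArg Subtype.val h) (Q.dir j)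
  rw [vertex_apply_dir, vertex_apply_dir] at this
  split_ifs at this <;> simp_all

theorem exists_vertex_eq (Q : CubeIn X q) {x : X} (hx : x ∈ Q.vertices) :
    ∃ s, Q.vertex s = x := by
  refine ⟨Finset.univ.filter fun j => (x : Fin n → ℤ) (Q.dir j) ≠ Q.low (Q.dir j),
    Subtype.ext (funext fun i => ?_)⟩
  have hi : Q.low i ≤ (x : Fin n → ℤ) i ∧ (x : Fin n → ℤ) i ≤ Q.high i := hx i trivial
  by_cases h : i ∈ Q.dirs
  · obtain ⟨j, rfl⟩ := Q.exists_dir_eq h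
    rw [vertex_apply_dir]
    rw [Q.high_dir] at hi
    by_cases h0 : (x : Fin n → ℤ) (Q.dir j) = Q.low (Q.dir j)
    · simp [h0]
    · rw [if_pos (by simpa using h0)]
      omega
  · have h' : i ∉ Finset.map Q.dir.toEmbedding (Finset.univ.filter fun j =>
        (x : Fin n → ℤ) (Q.dir j) ≠ Q.low (Q.dir j)) := fun h' => by
      obtain ⟨j, -, rfl⟩ := Finset.mem_map.mp h'
      exact h (Q.dir_mem j)
    simp only [ElementaryCube.high, h, if_false] at hi
    simp only [vertex, if_neg h']
    omega

theorem vertex_empty (Q : CubeIn X q) : Q.vertex ∅ = Q.corner := by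
  simp [vertex, corner]

theorem coe_vertex_insert (Q : CubeIn X q) {s : Finset (Fin q)} {j : Fin q} (hj : j ∉ s) :
    (Q.vertex (insert j s) : Fin n → ℤ) =
      (Q.vertex s : Fin n → ℤ) + Pi.single (Q.dir j) 1 := by
  ext i
  by_cases hi : i = Q.dir j
  · subst hi
    simp [vertex_apply_dir, hj]
  · simp [vertex, hi]

theorem adj_vertex_insert (Q : CubeIn X q) {s : Finset (Fin q)} {j : Fin q} (hj : j ∉ s) :
    (c1Image X).Adj (Q.vertex s) (Q.vertex (insert j s)) :=
  cGraph_one_adj_iff.mpr ⟨_, 1, Or.inl rfl, Q.coe_vertex_insert hj⟩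

theorem corner_mem (Q : CubeIn X q) : Q.corner ∈ Q.vertices := Q.low_mem

theorem neighbor_mem (Q : CubeIn X q) (j : Fin q) : Q.neighbor j ∈ Q.vertices := by
  intro i _
  by_cases hi : i = Q.dir j
  · subst hi
    simp [neighbor, ElementaryCube.high, Q.dir_mem j]
  · simpa [neighbor, Function.update_of_ne hi] using Q.low_le_high i

end CubeIn

/-! ### Injective continuous maps on a cube -/

section Injective

variable {m n q : ℕ} {X : Set (Fin m → ℤ)} {Y : Set (Fin n → ℤ)} {f : X → Y}

theorem imageSet_eq_image (f : X → Y) (Q : CubeIn X q) :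
    imageSet f Q = (fun x => (f x : Fin n → ℤ)) '' Q.vertices := rfl

theorem injOn_of_imageSet_eq {Q : CubeIn X q} {R : CubeIn Y q} (h : imageSet f Q = R.toSet) :
    Set.InjOn f Q.vertices := by
  have : Set.InjOn (fun x => (f x : Fin n → ℤ)) Q.vertices := by
    apply Set.injOn_of_ncard_image_eq _ Q.finite_vertices
    rw [← imageSet_eq_image, h, R.ncard_toSet, Q.ncard_vertices]
  exact fun x hx y hy hxy => this hx hy (congrArg Subtype.val hxy)

theorem pushCube_of_imageSet_eq {Q : CubeIn X q} {R : CubeIn Y q} (h : imageSet f Q = R.toSet) :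
    pushCube f Q = orientation f Q R • Finsupp.single R (1 : ℤ) := by
  have hex : ∃ R : CubeIn Y q, imageSet f Q = R.toSet := ⟨R, h⟩
  have : hex.choose = R := CubeIn.toElementaryCube_injective
    (ElementaryCube.toSet_injective (hex.choose_spec.symm.trans h))
  rw [pushCube, dif_pos hex, this]

theorem pushCube_of_not_injOn {Q : CubeIn X q} (h : ¬ Set.InjOn f Q.vertices) :
    pushCube f Q = 0 := by
  rw [pushCube, dif_neg]
  rintro ⟨R, hR⟩
  exact h (injOn_of_imageSet_eq hR)

/-- Moving in a fixed direction of the cube changes the value of an injective continuous map by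
the same vector at all vertices: every two-dimensional face is sent to a parallelogram. -/
theorem map_vertex_insert_sub (hf : IsContinuous (c1Image X) (c1Image Y) f) {Q : CubeIn X q}
    (hinj : Set.InjOn f Q.vertices) (j : Fin q) (s : Finset (Fin q)) (hj : j ∉ s) :
    (f (Q.vertex (insert j s)) : Fin n → ℤ) - f (Q.vertex s)
      = (f (Q.vertex {j}) : Fin n → ℤ) - f (Q.vertex ∅) := by
  have hne : ∀ s t, s ≠ t → f (Q.vertex s) ≠ f (Q.vertex t) := fun s t hst h =>
    hst (Q.vertex_injective (hinj (Q.vertex_mem s) (Q.vertex_mem t) h))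
  have hadj : ∀ s j, j ∉ s → (cGraph n 1).Adj (f (Q.vertex s) : Fin n → ℤ)
      (f (Q.vertex (insert j s))) := fun s j hj =>
    (hf (Q.adj_vertex_insert hj)).resolve_right
      (hne _ _ fun h => hj (h ▸ Finset.mem_insert_self j s))
  induction s using Finset.induction_on with
  | empty => rfl
  | insert i s hi ih =>
    rw [Finset.mem_insert, not_or] at hj
    rw [← ih hj.2]
    have hij : i ∉ insert j s := by simp [Ne.symm hj.1, hi]
    apply cGraph_one_parallelogram (hadj s i hi) (hadj s j hj.2)
      (hadj (insert i s) j (by simp [hj]))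
    · rw [Finset.insert_comm]
      exact hadj _ _ hij
    · refine fun h => hne _ _ ?_ (Subtype.ext h)
      intro h'
      exact hij (h' ▸ Finset.mem_insert_self i s)
    · refine fun h => hne _ _ ?_ (Subtype.ext h)
      intro h'
      exact hj.2 (h' ▸ Finset.mem_insert_self j _)

theorem map_vertex_eq (hf : IsContinuous (c1Image X) (c1Image Y) f) {Q : CubeIn X q}
    (hinj : Set.InjOn f Q.vertices) (s : Finset (Fin q)) :
    (f (Q.vertex s) : Fin n → ℤ) = (f (Q.vertex ∅) : Fin n → ℤ)
      + ∑ j ∈ s, ((f (Q.vertex {j}) : Fin n → ℤ) - f (Q.vertex ∅)) := by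
  induction s using Finset.induction_on with
  | empty => simp
  | insert i s hi ih =>
    rw [Finset.sum_insert hi, ← map_vertex_insert_sub hf hinj i s hi, add_left_comm, ← ih]
    abel

/-- `f` sends `Q` onto `R` by the signed coordinate permutation with permutation `σ` and
signs `e`. -/
structure IsSignedPerm (f : X → Y) (Q : CubeIn X q) (R : CubeIn Y q) (σ : Equiv.Perm (Fin q))
    (e : Fin q → ℤ) : Prop where
  imageSet_eq : imageSet f Q = R.toSet
  sign : ∀ j, e j = 1 ∨ e j = -1
  apply_dir : ∀ x ∈ Q.vertices, ∀ j, (f x : Fin n → ℤ) (R.dir (σ j))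
    = (f Q.corner : Fin n → ℤ) (R.dir (σ j)) + e j * ((x : Fin m → ℤ) (Q.dir j) - Q.low (Q.dir j))

/-- A continuous map that is injective on an elementary cube sends it onto an elementary cube of
the same dimension, by a signed coordinate permutation. -/
theorem exists_isSignedPerm (hf : IsContinuous (c1Image X) (c1Image Y) f) {Q : CubeIn X q}
    (hinj : Set.InjOn f Q.vertices) : ∃ R σ e, IsSignedPerm f Q R σ e := by
  have hne : ∀ s t, s ≠ t → f (Q.vertex s) ≠ f (Q.vertex t) := fun s t hst h =>
    hst (Q.vertex_injective (hinj (Q.vertex_mem s) (Q.vertex_mem t) h))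
  have hunit : ∀ j, ∃ k, ∃ e : ℤ, (e = 1 ∨ e = -1) ∧
      (f (Q.vertex {j}) : Fin n → ℤ) = (f (Q.vertex ∅) : Fin n → ℤ) + Pi.single k e := fun j => by
    apply cGraph_one_adj_iff.mp
    have := Q.adj_vertex_insert (s := ∅) (j := j) (by simp)
    exact (hf this).resolve_right (hne _ _ (by simp))
  choose τ e he hτ using hunit
  have hval : ∀ s, (f (Q.vertex s) : Fin n → ℤ) = (f (Q.vertex ∅) : Fin n → ℤ)
      + ∑ j ∈ s, Pi.single (τ j) (e j) :=
    fun s => by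
    rw [map_vertex_eq hf hinj s]
    simp [hτ]
  have hτinj : Function.Injective τ := by
    intro i j hij
    by_contra hne'
    by_cases hee : e i = e j
    · refine hne {i} {j} (by simpa using hne') (Subtype.ext ?_)
      rw [hτ, hτ, hij, hee]
    · refine hne {i, j} ∅ (by simp) (Subtype.ext ?_)
      have h0 : e i + e j = 0 := by have := he i; have := he j; omega
      rw [hval, Finset.sum_pair hne', hij, ← Pi.single_add, h0]
      simp
  have hin : ∀ s j, (f (Q.vertex s) : Fin n → ℤ) (τ j)
      = (f (Q.vertex ∅) : Fin n → ℤ) (τ j) + if j ∈ s then e j else 0 := fun s j => by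
    rw [hval s]
    simp [Finset.sum_apply, Pi.single_apply, hτinj.eq_iff]
  have hout : ∀ s k, (∀ j, τ j ≠ k) → (f (Q.vertex s) : Fin n → ℤ) k
      = (f (Q.vertex ∅) : Fin n → ℤ) k := fun s k hk => by
    rw [hval s]
    simp only [Pi.add_apply, Finset.sum_apply, add_eq_left]
    exact Finset.sum_eq_zero fun j _ => Pi.single_eq_of_ne (hk j).symm _
  classical
  let R₀ : ElementaryCube n :=
    ⟨fun k => (f (Q.vertex ∅) : Fin n → ℤ) k - if ∃ j, τ j = k ∧ e j = -1 then 1 else 0,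
      Finset.univ.image τ⟩
  have hcard : R₀.dirs.card = q := by
    simp [R₀, Finset.card_image_of_injective _ hτinj]
  have hsub : imageSet f Q ⊆ R₀.toSet := by
    rintro _ ⟨x, hx, rfl⟩ k -
    obtain ⟨s, rfl⟩ := Q.exists_vertex_eq hx
    by_cases hk : ∃ j, τ j = k
    · obtain ⟨j, rfl⟩ := hk
      rw [hin]
      have := he j
      simp only [ElementaryCube.high, R₀, hτinj.eq_iff, exists_eq_left, Set.mem_Icc,
        Finset.mem_image, Finset.mem_univ, true_and, exists_eq, if_true]
      split_ifs <;> omega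
    · rw [hout s k (by simpa using hk)]
      have h1 : ¬ ∃ j, τ j = k ∧ e j = -1 := fun ⟨j, h, _⟩ => hk ⟨j, h⟩
      simp [ElementaryCube.high, R₀, h1, hk]
  have hfin : R₀.toSet.Finite :=
    Set.finite_of_ncard_pos (by rw [ElementaryCube.ncard_toSet]; positivity)
  have heq : imageSet f Q = R₀.toSet := by
    refine Set.eq_of_subset_of_ncard_le hsub ?_ hfin
    rw [ElementaryCube.ncard_toSet, hcard, imageSet_eq_image, Set.InjOn.ncard_image
      (fun x hx y hy h => hinj hx hy (Subtype.ext h)), Q.ncard_vertices]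
  let R : CubeIn Y q := ⟨R₀, hcard, by
    rw [← heq]
    rintro _ ⟨x, -, rfl⟩
    exact (f x).2⟩
  have hσ : ∀ j, ∃ i, R.dir i = τ j := fun j =>
    R.exists_dir_eq (Finset.mem_image_of_mem τ (Finset.mem_univ j))
  choose σ hσ using hσ
  have hσinj : Function.Injective σ := fun i j hij => hτinj (by rw [← hσ, ← hσ, hij])
  refine ⟨R, Equiv.ofBijective σ (Finite.injective_iff_bijective.mp hσinj), e, heq, he, ?_⟩
  intro x hx j
  obtain ⟨s, rfl⟩ := Q.exists_vertex_eq hx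
  rw [← Q.vertex_empty, Equiv.ofBijective_apply, hσ, hin s j, Q.vertex_apply_dir]
  split_ifs <;> simp

end Injective

/-! ### The chain map identity on a cube with injective image -/

section Signed

variable {m n q : ℕ} {X : Set (Fin m → ℤ)} {Y : Set (Fin n → ℤ)} {f : X → Y}

theorem boundary_single (Q : CubeIn X (q + 1)) :
    boundary X q (Finsupp.single Q 1) = ∑ i : Fin (q + 1), (-1 : ℤ) ^ ((i : ℕ) + 1) •
      (Finsupp.single (Q.faceA i) (1 : ℤ) - Finsupp.single (Q.faceB i) (1 : ℤ)) := by
  simp [boundary]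

theorem pushChain_single (f : X → Y) (Q : CubeIn X q) :
    pushChain f q (Finsupp.single Q 1) = pushCube f Q := by
  simp [pushChain]

theorem CubeIn.faceA_dir (Q : CubeIn X (q + 1)) (i : Fin (q + 1)) (j : Fin q) :
    (Q.faceA i).dir j = Q.dir (i.succAbove j) := CubeIn.dir_eq_of Q i _ rfl j

theorem CubeIn.faceB_dir (Q : CubeIn X (q + 1)) (i : Fin (q + 1)) (j : Fin q) :
    (Q.faceB i).dir j = Q.dir (i.succAbove j) := CubeIn.dir_eq_of Q i _ rfl j

namespace IsSignedPerm

theorem map_mem {Q : CubeIn X q} {R : CubeIn Y q} {σ : Equiv.Perm (Fin q)} {e : Fin q → ℤ}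
    (h : IsSignedPerm f Q R σ e) {x : X} (hx : x ∈ Q.vertices) :
    (f x : Fin n → ℤ) ∈ R.toSet := h.imageSet_eq ▸ ⟨x, hx, rfl⟩

theorem map_corner {Q : CubeIn X q} {R : CubeIn Y q} {σ : Equiv.Perm (Fin q)} {e : Fin q → ℤ}
    (h : IsSignedPerm f Q R σ e) (l : Fin q) : (f Q.corner : Fin n → ℤ) (R.dir (σ l))
      = R.low (R.dir (σ l)) + if e l = 1 then 0 else 1 := by
  have h1 := h.map_mem Q.corner_mem (R.dir (σ l)) trivial
  have h2 := h.map_mem (Q.neighbor_mem l) (R.dir (σ l)) trivial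
  rw [h.apply_dir _ (Q.neighbor_mem l)] at h2
  simp only [CubeIn.neighbor, Function.update_self, R.high_dir, Set.mem_Icc] at h1 h2
  rcases h.sign l with he | he <;> simp [he] at h2 ⊢ <;> omega

theorem map_neighbor_sub {Q : CubeIn X q} {R : CubeIn Y q} {σ : Equiv.Perm (Fin q)}
    {e : Fin q → ℤ} (h : IsSignedPerm f Q R σ e) {p : ℕ} (Q' : CubeIn X p)
    (hsub : Q'.vertices ⊆ Q.vertices) (i j : Fin q) (k : Fin p) (hk : Q'.dir k = Q.dir j) :
    (f (Q'.neighbor k) : Fin n → ℤ) (R.dir i) - (f Q'.corner : Fin n → ℤ) (R.dir i)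
      = if i = σ j then e j else 0 := by
  obtain ⟨i, rfl⟩ := σ.surjective i
  rw [h.apply_dir _ (hsub (Q'.neighbor_mem k)), h.apply_dir _ (hsub Q'.corner_mem)]
  by_cases hij : i = j
  · subst hij
    simp only [CubeIn.neighbor, CubeIn.corner, hk, Function.update_self, if_true]
    ring
  · simp [CubeIn.neighbor, CubeIn.corner, hk, hij]

variable {Q : CubeIn X (q + 1)} {R : CubeIn Y (q + 1)} {σ : Equiv.Perm (Fin (q + 1))}
  {e : Fin (q + 1) → ℤ}

theorem imageSet_faceA (h : IsSignedPerm f Q R σ e) (l : Fin (q + 1)) :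
    imageSet f (Q.faceA l) = (if e l = 1 then R.faceA (σ l) else R.faceB (σ l)).toSet := by
  have hc := h.map_corner l
  ext y
  constructor
  · rintro ⟨x, hx, rfl⟩
    rw [Q.mem_faceA_iff] at hx
    have h1 := h.apply_dir x hx.1 l
    rw [hx.2, hc, sub_self, mul_zero, add_zero] at h1
    split_ifs at h1 ⊢
    · exact (R.mem_faceA_iff _ _).mpr ⟨h.map_mem hx.1, by omega⟩
    · exact (R.mem_faceB_iff _ _).mpr ⟨h.map_mem hx.1, h1⟩
  · intro hy
    have hy' : y ∈ R.toSet ∧ y (R.dir (σ l)) = R.low (R.dir (σ l)) + if e l = 1 then 0 else 1 := by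
      split_ifs at hy ⊢
      · simpa [R.mem_faceA_iff] using hy
      · simpa [R.mem_faceB_iff] using hy
    obtain ⟨hyR, hyl⟩ := hy'
    rw [← h.imageSet_eq] at hyR
    obtain ⟨x, hx, rfl⟩ := hyR
    refine ⟨x, (Q.mem_faceA_iff _ _).mpr ⟨hx, ?_⟩, rfl⟩
    have h1 := h.apply_dir x hx l
    rcases h.sign l with he | he <;> simp only [he] at h1 hyl hc <;> omega

theorem imageSet_faceB (h : IsSignedPerm f Q R σ e) (l : Fin (q + 1)) :
    imageSet f (Q.faceB l) = (if e l = 1 then R.faceB (σ l) else R.faceA (σ l)).toSet := by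
  have hc := h.map_corner l
  ext y
  constructor
  · rintro ⟨x, hx, rfl⟩
    rw [Q.mem_faceB_iff] at hx
    have h1 := h.apply_dir x hx.1 l
    rw [hx.2, hc] at h1
    rcases h.sign l with he | he <;> simp only [he] at h1 ⊢
    · exact (R.mem_faceB_iff _ _).mpr ⟨h.map_mem hx.1, by norm_num at h1; omega⟩
    · exact (R.mem_faceA_iff _ _).mpr ⟨h.map_mem hx.1, by norm_num at h1; omega⟩
  · intro hy
    have hy' : y ∈ R.toSet ∧ y (R.dir (σ l)) = R.low (R.dir (σ l)) + if e l = 1 then 1 else 0 := by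
      split_ifs at hy ⊢
      · simpa [R.mem_faceB_iff] using hy
      · simpa [R.mem_faceA_iff] using hy
    obtain ⟨hyR, hyl⟩ := hy'
    rw [← h.imageSet_eq] at hyR
    obtain ⟨x, hx, rfl⟩ := hyR
    refine ⟨x, (Q.mem_faceB_iff _ _).mpr ⟨hx, ?_⟩, rfl⟩
    have h1 := h.apply_dir x hx l
    rcases h.sign l with he | he <;> simp only [he] at h1 hyl hc <;> norm_num at h1 hyl hc <;> omega

theorem orientation_eq_det {p : ℕ} {Q : CubeIn X p} {R : CubeIn Y p} {σ : Equiv.Perm (Fin p)}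
    {e : Fin p → ℤ} (h : IsSignedPerm f Q R σ e) :
    orientation f Q R = (Matrix.of fun i j => if i = σ j then e j else 0).det := by
  unfold orientation
  congr 2
  ext i j
  exact h.map_neighbor_sub Q subset_rfl i j j rfl

theorem orientation_face (h : IsSignedPerm f Q R σ e) (l : Fin (q + 1)) (Q' : CubeIn X q)
    (R' : CubeIn Y q) (hsub : Q'.vertices ⊆ Q.vertices)
    (hQ : ∀ j, Q'.dir j = Q.dir (l.succAbove j))
    (hR : ∀ j, R'.dir j = R.dir ((σ l).succAbove j)) :
    orientation f Q' R' = ((Matrix.of fun i j => if i = σ j then e j else 0).submatrix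
      (σ l).succAbove l.succAbove).det := by
  unfold orientation
  congr 1
  ext i j
  simp only [Matrix.of_apply, Matrix.submatrix_apply, hR]
  exact h.map_neighbor_sub Q' hsub _ _ j (hQ j)

theorem map_boundary (h : IsSignedPerm f Q R σ e) :
    pushChain f q (boundary X q (Finsupp.single Q 1))
      = boundary Y q (pushChain f (q + 1) (Finsupp.single Q 1)) := by
  set M : Matrix (Fin (q + 1)) (Fin (q + 1)) ℤ := Matrix.of fun i j => if i = σ j then e j else 0
    with hM
  let ε : Fin (q + 1) → ℤ := fun l => (M.submatrix (σ l).succAbove l.succAbove).det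
  have hdet : ∀ l, M.det = (-1) ^ ((σ l : ℕ) + (l : ℕ)) * e l * ε l := fun l => by
    rw [Matrix.det_succ_column M l, Finset.sum_eq_single (σ l)]
    · simp [hM, ε]
    · intro i _ hi
      simp [hM, hi]
    · simp
  have hsubA : ∀ l, (Q.faceA l).vertices ⊆ Q.vertices := fun l x hx =>
    ElementaryCube.faceA_subset _ _ hx
  have hsubB : ∀ l, (Q.faceB l).vertices ⊆ Q.vertices := fun l x hx =>
    ElementaryCube.faceB_subset _ _ hx
  have hA : ∀ l, pushCube f (Q.faceA l)
      = ε l • Finsupp.single (if e l = 1 then R.faceA (σ l) else R.faceB (σ l)) 1 := fun l => by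
    rw [pushCube_of_imageSet_eq (h.imageSet_faceA l),
      h.orientation_face l _ _ (hsubA l) (Q.faceA_dir l)]
    intro j
    split_ifs
    exacts [R.faceA_dir _ j, R.faceB_dir _ j]
  have hB : ∀ l, pushCube f (Q.faceB l)
      = ε l • Finsupp.single (if e l = 1 then R.faceB (σ l) else R.faceA (σ l)) 1 := fun l => by
    rw [pushCube_of_imageSet_eq (h.imageSet_faceB l),
      h.orientation_face l _ _ (hsubB l) (Q.faceB_dir l)]
    intro j
    split_ifs
    exacts [R.faceB_dir _ j, R.faceA_dir _ j]
  rw [pushChain_single, pushCube_of_imageSet_eq h.imageSet_eq, map_smul, boundary_single,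
    boundary_single, h.orientation_eq_det, ← hM, map_sum, Finset.smul_sum,
    ← Equiv.sum_comp σ fun i => M.det • ((-1 : ℤ) ^ ((i : ℕ) + 1) •
      (Finsupp.single (R.faceA i) (1 : ℤ) - Finsupp.single (R.faceB i) (1 : ℤ)))]
  refine Finset.sum_congr rfl fun l _ => ?_
  rw [map_smul, map_sub, pushChain_single, pushChain_single, hA, hB, smul_smul, hdet l]
  have hs : ((-1 : ℤ) ^ (σ l : ℕ)) * (-1) ^ (σ l : ℕ) = 1 := by
    rw [← mul_pow]; simp
  have hc : (-1 : ℤ) ^ ((σ l : ℕ) + (l : ℕ)) * e l * ε l * (-1) ^ ((σ l : ℕ) + 1)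
      = (-1) ^ ((l : ℕ) + 1) * (e l * ε l) := by
    rw [pow_add, pow_succ, pow_succ]
    linear_combination (-(-1 : ℤ) ^ (l : ℕ) * e l * ε l) * hs
  rw [hc]
  rcases h.sign l with he | he
  · rw [he]
    simp only [if_true]
    module
  · rw [he]
    simp only [show ¬ ((-1 : ℤ) = 1) by norm_num, if_false]
    module

end IsSignedPerm

end Signed

/-! ### Nonzero cycles have many vertices -/

section Cycles

variable {n q : ℕ} {Y : Set (Fin n → ℤ)}

/-- The augmentation: the sum of the coefficients of a chain of points. -/
noncomputable def augmentation (Y : Set (Fin n → ℤ)) : Chain Y 0 →ₗ[ℤ] ℤ :=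
  Finsupp.linearCombination ℤ fun _ => 1

/-- Cycles of the augmented complex: in degree `0` the coefficients have to add up to `0`. -/
def IsReducedCycle : (q : ℕ) → Chain Y q → Prop
  | 0, z => augmentation Y z = 0
  | q + 1, z => boundary Y q z = 0

/-- The points that lie on a cube occurring in the chain `z`. -/
def chainVertices (z : Chain Y q) : Set (Fin n → ℤ) := ⋃ R ∈ z.support, R.toSet

theorem mem_chainVertices {z : Chain Y q} {x : Fin n → ℤ} :
    x ∈ chainVertices z ↔ ∃ R ∈ z.support, x ∈ R.toSet := by
  simp [chainVertices]

theorem finite_chainVertices (z : Chain Y q) : (chainVertices z).Finite :=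
  Set.Finite.biUnion z.support.finite_toSet fun R _ => R.finite_toSet

/-- The slice of a chain by the slab `a ≤ x_i ≤ a + 1`: each cube which crosses the slab and has
`i` as its first nondegenerate direction is replaced by its face in the hyperplane `x_i = a`, and
the other cubes are dropped. -/
noncomputable def slice (Y : Set (Fin n → ℤ)) (q : ℕ) (i : Fin n) (a : ℤ) :
    Chain Y (q + 1) →ₗ[ℤ] Chain Y q :=
  Finsupp.linearCombination ℤ fun R =>
    if R.dir 0 = i ∧ R.low i = a then Finsupp.single (R.faceA 0) 1 else 0

theorem slice_single (i : Fin n) (a : ℤ) (R : CubeIn Y (q + 1)) :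
    slice Y q i a (Finsupp.single R 1)
      = if R.dir 0 = i ∧ R.low i = a then Finsupp.single (R.faceA 0) 1 else 0 := by
  simp [slice]

theorem map_eq_zero_of_forall_single {ι M : Type*} [AddCommGroup M] (L : (ι →₀ ℤ) →ₗ[ℤ] M)
    (z : ι →₀ ℤ) (h : ∀ i ∈ z.support, L (Finsupp.single i 1) = 0) : L z = 0 := by
  rw [← Finsupp.sum_single z, Finsupp.sum, map_sum]
  refine Finset.sum_eq_zero fun i hi => ?_
  rw [← mul_one (z i), ← smul_eq_mul, ← Finsupp.smul_single, map_smul, h i hi, smul_zero]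

theorem CubeIn.faceB_low_of_ne (R : CubeIn Y (q + 1)) (l : Fin (q + 1)) {i : Fin n}
    (hi : i ≠ R.dir l) : (R.faceB l).low i = R.low i :=
  Function.update_of_ne hi _ _

/-- Up to sign, slicing along the smallest direction commutes with the boundary: removing the
direction `i`, which comes first, shifts the number of every other direction by one. -/
theorem boundary_slice_add (i : Fin n) (a : ℤ) (R : CubeIn Y (q + 2)) (hi : i ≤ R.dir 0) :
    boundary Y q (slice Y (q + 1) i a (Finsupp.single R 1))
      + slice Y q i a (boundary Y (q + 1) (Finsupp.single R 1)) = 0 := by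
  have hi' : R.dir (Fin.succAbove 0 0) ≠ i :=
    (hi.trans_lt (R.dir.strictMono (by simp))).ne'
  have hne : ∀ l : Fin (q + 1), R.dir 0 ≠ R.dir l.succ := fun l h =>
    Fin.succ_ne_zero l (R.dir.injective h).symm
  rw [slice_single, boundary_single, map_sum, Fin.sum_univ_succ]
  simp only [map_smul, map_sub, slice_single, R.faceA_dir, R.faceB_dir,
    Fin.succ_succAbove_zero, hi', false_and, if_false, sub_self, smul_zero, zero_add]
  by_cases h0 : R.dir 0 = i
  · subst h0
    have hB : ∀ l : Fin (q + 1), (R.faceB l.succ).low (R.dir 0) = R.low (R.dir 0) := fun l =>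
      R.faceB_low_of_ne _ (hne l)
    have hA : ∀ l : Fin (q + 1), (R.faceA l.succ).low (R.dir 0) = R.low (R.dir 0) := fun l => rfl
    simp only [true_and, hA, hB]
    split_ifs with ha
    · rw [boundary_single, ← Finset.sum_add_distrib]
      refine Finset.sum_eq_zero fun l _ => ?_
      have hAA : (R.faceA 0).faceA l = (R.faceA l.succ).faceA 0 := by
        ext1
        · rfl
        · change (R.dirs.erase _).erase _ = (R.dirs.erase _).erase _
          rw [R.faceA_dir, R.faceA_dir, Finset.erase_right_comm]
          simp
      have hBA : (R.faceA 0).faceB l = (R.faceB l.succ).faceA 0 := by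
        ext1
        · change Function.update _ _ _ = Function.update _ _ _
          rw [CubeIn.high_dir, R.faceA_dir, CubeIn.high_dir]
          simp [CubeIn.faceA, ElementaryCube.faceA]
        · change (R.dirs.erase _).erase _ = (R.dirs.erase _).erase _
          rw [R.faceA_dir, R.faceB_dir, Finset.erase_right_comm]
          simp
      rw [hAA, hBA, Fin.val_succ, pow_succ _ ((l : ℕ) + 1)]
      module
    · simp
  · simp [h0]

/-- The edges of a one-dimensional cycle that cross a slab cancel: a closed curve crosses the slab
equally often in both directions. -/
theorem augmentation_slice (i : Fin n) (a : ℤ) {z : Chain Y 1} (hz : boundary Y 0 z = 0) :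
    augmentation Y (slice Y 0 i a z) = 0 := by
  -- `φ` counts the points of the half space `x_i ≤ a`; `φ ∘ ∂` detects the crossing edges.
  let φ : Chain Y 0 →ₗ[ℤ] ℤ := Finsupp.linearCombination ℤ fun P => if P.low i ≤ a then 1 else 0
  have h : augmentation Y ∘ₗ slice Y 0 i a + φ ∘ₗ boundary Y 0 = 0 := by
    refine Finsupp.lhom_ext' fun R => LinearMap.ext_ring ?_
    simp only [LinearMap.comp_apply, Finsupp.lsingle_apply, LinearMap.add_apply, slice_single,
      boundary_single, LinearMap.zero_apply, map_smul, map_sub, φ,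
      Finsupp.linearCombination_single, Fin.sum_univ_succ, Finset.univ_eq_empty,
      Finset.sum_empty, add_zero]
    by_cases h0 : R.dir 0 = i
    · subst h0
      have hA : (R.faceA 0).low (R.dir 0) = R.low (R.dir 0) := rfl
      have hB : (R.faceB 0).low (R.dir 0) = R.low (R.dir 0) + 1 := by
        simp [CubeIn.faceB, ElementaryCube.faceB, R.high_dir]
      rw [hA, hB]
      by_cases ha : R.low (R.dir 0) = a
      · simp [ha, augmentation]
      · have : R.low (R.dir 0) + 1 ≤ a ↔ R.low (R.dir 0) ≤ a := by omega
        simp [ha, this]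
    · have hB : (R.faceB 0).low i = R.low i := R.faceB_low_of_ne 0 (Ne.symm h0)
      have hA : (R.faceA 0).low i = R.low i := rfl
      simp [h0, hA, hB]
  have := LinearMap.congr_fun h z
  simpa [hz] using this

theorem CubeIn.eq_of_faceA_eq {R S : CubeIn Y (q + 1)} (hdir : R.dir 0 = S.dir 0)
    (h : R.faceA 0 = S.faceA 0) : R = S := by
  have hlow : (R.faceA 0).low = (S.faceA 0).low := by rw [h]
  have hdirs : R.dirs.erase (R.dir 0) = S.dirs.erase (S.dir 0) :=
    congrArg (fun T : CubeIn Y q => T.dirs) h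
  ext1
  · exact hlow
  · rw [← Finset.insert_erase (R.dir_mem 0), ← Finset.insert_erase (S.dir_mem 0), hdirs, hdir]

theorem slice_apply_faceA (z : Chain Y (q + 1)) (R : CubeIn Y (q + 1)) :
    slice Y q (R.dir 0) (R.low (R.dir 0)) z (R.faceA 0) = z R := by
  rw [slice, Finsupp.linearCombination_apply, Finsupp.sum, Finsupp.finsetSum_apply,
    Finset.sum_eq_single R]
  · simp
  · intro S _ hS
    split_ifs with h
    · have : S.faceA 0 ≠ R.faceA 0 := fun h' => hS (CubeIn.eq_of_faceA_eq h.1 h')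
      simp [Finsupp.single_eq_of_ne this.symm]
    · simp
  · intro hR
    simp [Finsupp.notMem_support_iff.mp hR]

theorem exists_of_mem_support_slice {i : Fin n} {a : ℤ} {z : Chain Y (q + 1)} {T : CubeIn Y q}
    (hT : T ∈ (slice Y q i a z).support) :
    ∃ R ∈ z.support, R.dir 0 = i ∧ R.low i = a ∧ R.faceA 0 = T := by
  by_contra! hcon
  refine Finsupp.mem_support_iff.mp hT ?_
  rw [slice, Finsupp.linearCombination_apply, Finsupp.sum, Finsupp.finsetSum_apply]
  refine Finset.sum_eq_zero fun S hS => ?_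
  split_ifs with h
  · simp [Finsupp.single_eq_of_ne (hcon S hS h.1 h.2).symm]
  · simp

theorem CubeIn.add_single_mem {R : CubeIn Y (q + 1)} {l : Fin (q + 1)} {x : Fin n → ℤ}
    (hx : x ∈ (R.faceA l).toSet) : x + Pi.single (R.dir l) 1 ∈ R.toSet := by
  rw [R.mem_faceA_iff] at hx
  intro i _
  by_cases hi : i = R.dir l
  · subst hi
    simp [hx.2, R.high_dir]
  · simpa [Pi.single_eq_of_ne hi] using hx.1 i trivial

/-- Passing to a nonzero slice halves the number of vertices at least: the vertices of the slice
occur on both sides of the slab. -/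
theorem two_mul_ncard_chainVertices_slice_le (i : Fin n) (a : ℤ) (z : Chain Y (q + 1)) :
    2 * (chainVertices (slice Y q i a z)).ncard ≤ (chainVertices z).ncard := by
  set W := chainVertices (slice Y q i a z) with hW
  have hWa : ∀ x ∈ W, x i = a ∧ x ∈ chainVertices z ∧ x + Pi.single i 1 ∈ chainVertices z := by
    intro x hx
    obtain ⟨T, hT, hxT⟩ := mem_chainVertices.mp hx
    obtain ⟨R, hR, rfl, ha, rfl⟩ := exists_of_mem_support_slice hT
    refine ⟨?_, mem_chainVertices.mpr ⟨R, hR, ElementaryCube.faceA_subset _ _ hxT⟩,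
      mem_chainVertices.mpr ⟨R, hR, CubeIn.add_single_mem hxT⟩⟩
    rw [((R.mem_faceA_iff _ _).mp hxT).2, ha]
  have hfin : W.Finite := finite_chainVertices _
  let s : (Fin n → ℤ) → (Fin n → ℤ) := fun x => x + Pi.single i 1
  have hdisj : Disjoint W (s '' W) := by
    rw [Set.disjoint_left]
    rintro _ hx ⟨y, hy, rfl⟩
    have h1 := (hWa _ hx).1
    have h2 := (hWa _ hy).1
    simp [s, h2] at h1
  have hcard : (s '' W).ncard = W.ncard :=
    Set.ncard_image_of_injective _ (add_left_injective _)
  calc 2 * W.ncard = (W ∪ s '' W).ncard := by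
        rw [Set.ncard_union_eq hdisj hfin (hfin.image s), hcard, two_mul]
    _ ≤ (chainVertices z).ncard := by
        refine Set.ncard_le_ncard ?_ (finite_chainVertices z)
        rintro x (hx | ⟨y, hy, rfl⟩)
        exacts [(hWa x hx).2.1, (hWa y hy).2.2]

/-- A nonzero cycle of dimension `q` has at least as many vertices as the boundary of a cube of
dimension `q + 1`. -/
theorem IsReducedCycle.two_pow_le {z : Chain Y q} (hz : IsReducedCycle q z) (hne : z ≠ 0) :
    2 ^ (q + 1) ≤ (chainVertices z).ncard := by
  induction q with
  | zero =>
    obtain ⟨P, hP⟩ := Finsupp.support_nonempty_iff.mpr hne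
    have hz' : ∑ R ∈ z.support, z R = 0 := by
      have : augmentation Y z = 0 := hz
      simpa [augmentation, Finsupp.linearCombination_apply, Finsupp.sum] using this
    obtain ⟨R, hR, hRP⟩ : ∃ R ∈ z.support, R ≠ P := by
      by_contra! hcon
      rw [Finset.sum_eq_single P (fun R hR h => absurd (hcon R hR) h) (fun h => absurd hP h)] at hz'
      exact Finsupp.mem_support_iff.mp hP hz'
    have hlow : R.low ≠ P.low := fun h => hRP <| by
      ext1
      · exact h
      · rw [Finset.card_eq_zero.mp R.card_dirs, Finset.card_eq_zero.mp P.card_dirs]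
    calc 2 ^ (0 + 1) = ({R.low, P.low} : Set (Fin n → ℤ)).ncard := by
          rw [Set.ncard_pair hlow]; norm_num
      _ ≤ (chainVertices z).ncard := by
          refine Set.ncard_le_ncard ?_ (finite_chainVertices z)
          rintro x (rfl | rfl)
          exacts [mem_chainVertices.mpr ⟨R, hR, R.low_mem⟩,
            mem_chainVertices.mpr ⟨P, hP, P.low_mem⟩]
  | succ q ih =>
    -- The slices commute with the boundary only along the smallest direction that occurs in `z`.
    obtain ⟨R, hR, hmin⟩ := Finset.exists_min_image z.support (fun R => R.dir 0)
      (Finsupp.support_nonempty_iff.mpr hne)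
    have hcyc : IsReducedCycle q (slice Y q (R.dir 0) (R.low (R.dir 0)) z) := by
      have hz' : boundary Y q z = 0 := hz
      cases q with
      | zero => exact augmentation_slice _ _ hz'
      | succ q =>
        have := map_eq_zero_of_forall_single
          (boundary Y q ∘ₗ slice Y (q + 1) (R.dir 0) (R.low (R.dir 0))
            + slice Y q (R.dir 0) (R.low (R.dir 0)) ∘ₗ boundary Y (q + 1)) z
          (fun S hS => boundary_slice_add _ _ S (hmin S hS))
        change boundary Y q _ = 0
        simpa [hz'] using this
    have hne' : slice Y q (R.dir 0) (R.low (R.dir 0)) z ≠ 0 := fun h => by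
      have := slice_apply_faceA z R
      rw [h] at this
      exact Finsupp.mem_support_iff.mp hR this.symm
    have := ih hcyc hne'
    have := two_mul_ncard_chainVertices_slice_le (R.dir 0) (R.low (R.dir 0)) z
    rw [pow_succ]
    omega

end Cycles

/-! ### Continuous maps induce chain maps -/

section ChainMap

variable {m n q : ℕ} {X : Set (Fin m → ℤ)} {Y : Set (Fin n → ℤ)} {f : X → Y}

theorem toSet_eq_of_mem_support_pushCube {Q : CubeIn X q} {R : CubeIn Y q}
    (hR : R ∈ (pushCube f Q).support) : R.toSet = imageSet f Q := by
  by_cases h : ∃ R : CubeIn Y q, imageSet f Q = R.toSet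
  · obtain ⟨S, hS⟩ := h
    rw [pushCube_of_imageSet_eq hS] at hR
    have := Finsupp.support_single_subset (Finsupp.support_smul hR)
    rw [Finset.mem_singleton.mp this, hS]
  · rw [pushCube, dif_neg h] at hR
    simp at hR

theorem augmentation_comp_pushChain (hf : IsContinuous (c1Image X) (c1Image Y) f) :
    augmentation Y ∘ₗ pushChain f 0 = augmentation X := by
  refine Finsupp.lhom_ext' fun Q => LinearMap.ext_ring ?_
  have hinj : Set.InjOn f Q.vertices := fun x hx y hy _ =>
    (Set.ncard_le_one Q.finite_vertices).mp (by rw [Q.ncard_vertices, pow_zero]) x hx y hy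
  obtain ⟨R, σ, e, h⟩ := exists_isSignedPerm hf hinj
  simp [pushChain_single, pushCube_of_imageSet_eq h.imageSet_eq, augmentation, orientation]

theorem augmentation_comp_boundary : augmentation X ∘ₗ boundary X 0 = 0 := by
  refine Finsupp.lhom_ext' fun Q => LinearMap.ext_ring ?_
  simp [boundary_single, augmentation]

theorem isReducedCycle_boundary (w : Chain X (q + 1)) : IsReducedCycle q (boundary X q w) := by
  cases q with
  | zero => exact LinearMap.congr_fun augmentation_comp_boundary w
  | succ q => exact LinearMap.congr_fun (boundary_boundary X q) w

theorem chainVertices_map_boundary_subset (f : X → Y) (Q : CubeIn X (q + 1)) :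
    chainVertices (pushChain f q (boundary X q (Finsupp.single Q 1))) ⊆ imageSet f Q := by
  intro y hy
  obtain ⟨R, hR, hyR⟩ := mem_chainVertices.mp hy
  by_contra hcon
  have hA : ∀ l, pushCube f (Q.faceA l) R = 0 := fun l => by
    by_contra h
    rw [toSet_eq_of_mem_support_pushCube (Finsupp.mem_support_iff.mpr h)] at hyR
    obtain ⟨x, hx, rfl⟩ := hyR
    exact hcon ⟨x, ElementaryCube.faceA_subset _ _ hx, rfl⟩
  have hB : ∀ l, pushCube f (Q.faceB l) R = 0 := fun l => by
    by_contra h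
    rw [toSet_eq_of_mem_support_pushCube (Finsupp.mem_support_iff.mpr h)] at hyR
    obtain ⟨x, hx, rfl⟩ := hyR
    exact hcon ⟨x, ElementaryCube.faceB_subset _ _ hx, rfl⟩
  refine Finsupp.mem_support_iff.mp hR ?_
  rw [boundary_single, map_sum, Finsupp.finsetSum_apply]
  refine Finset.sum_eq_zero fun l _ => ?_
  rw [map_smul, map_sub, pushChain_single, pushChain_single, Finsupp.smul_apply,
    Finsupp.sub_apply, hA, hB, sub_self, smul_zero]

/-- If the map is injective on the cube `Q`, it acts there as a signed coordinate permutation.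
Otherwise the image of the boundary of `Q` is a cycle with too few vertices to be nonzero. -/
theorem map_boundary_of_isReducedCycle (hf : IsContinuous (c1Image X) (c1Image Y) f)
    (Q : CubeIn X (q + 1))
    (hcyc : IsReducedCycle q (pushChain f q (boundary X q (Finsupp.single Q 1)))) :
    pushChain f q (boundary X q (Finsupp.single Q 1))
      = boundary Y q (pushChain f (q + 1) (Finsupp.single Q 1)) := by
  by_cases hinj : Set.InjOn f Q.vertices
  · obtain ⟨R, σ, e, h⟩ := exists_isSignedPerm hf hinj
    exact h.map_boundary
  · rw [pushChain_single, pushCube_of_not_injOn hinj, map_zero]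
    by_contra hne
    have h1 := hcyc.two_pow_le hne
    have hfin : (imageSet f Q).Finite := Q.finite_vertices.image _
    have h2 := Set.ncard_le_ncard (chainVertices_map_boundary_subset f Q) hfin
    have h3 : (imageSet f Q).ncard < 2 ^ (q + 1) := by
      rw [← Q.ncard_vertices, imageSet_eq_image]
      refine lt_of_le_of_ne (Set.ncard_image_le Q.finite_vertices) fun h => hinj ?_
      exact fun x hx y hy hxy => Set.injOn_of_ncard_image_eq h Q.finite_vertices hx hy
        (congrArg Subtype.val hxy)
    omega

/-- Every continuous map induces a chain map, in all dimensions. -/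
theorem IsContinuous.isChainMap (hf : IsContinuous (c1Image X) (c1Image Y) f) : IsChainMap f := by
  intro q
  induction q with
  | zero =>
    refine Finsupp.lhom_ext' fun Q => LinearMap.ext_ring
      (map_boundary_of_isReducedCycle hf Q ?_)
    exact (LinearMap.congr_fun (augmentation_comp_pushChain hf) _).trans
      (isReducedCycle_boundary (Finsupp.single Q (1 : ℤ)))
  | succ q ih =>
    refine Finsupp.lhom_ext' fun Q => LinearMap.ext_ring
      (map_boundary_of_isReducedCycle hf Q ?_)
    have h : boundary X q (boundary X (q + 1) (Finsupp.single Q 1)) = 0 :=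
      isReducedCycle_boundary (Finsupp.single Q (1 : ℤ))
    change boundary Y q _ = 0
    rw [← LinearMap.comp_apply, ← ih, LinearMap.comp_apply, h, map_zero]

end ChainMap

/-! ### Prisms and homotopy invariance -/

section Homotopy

variable {m n q : ℕ} {X : Set (Fin m → ℤ)} {Y : Set (Fin n → ℤ)}

/-- The cylinder `{0, 1} × X`; the additional coordinate comes first. -/
def cylinder (X : Set (Fin m → ℤ)) : Set (Fin (m + 1) → ℤ) :=
  {p | (p 0 = 0 ∨ p 0 = 1) ∧ Fin.tail p ∈ X}

/-- The projection of the cylinder onto its base. -/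
def cylinderProj (p : cylinder X) : X :=
  ⟨Fin.tail (α := fun _ => ℤ) p, p.2.2⟩

/-- The map on the cylinder which is `f` on the bottom and `g` on the top. -/
def cylinderMap (f g : X → Y) (p : cylinder X) : Y :=
  if (p : Fin (m + 1) → ℤ) 0 = 0 then f (cylinderProj p) else g (cylinderProj p)

/-- One step of a homotopy is a continuous map on the cylinder. -/
theorem isContinuous_cylinderMap {f g : X → Y} (hf : IsContinuous (c1Image X) (c1Image Y) f)
    (hg : IsContinuous (c1Image X) (c1Image Y) g)
    (hfg : ∀ x, (c1Image Y).Adj (f x) (g x) ∨ f x = g x) :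
    IsContinuous (c1Image (cylinder X)) (c1Image Y) (cylinderMap f g) := by
  rintro ⟨x, hx0, hx⟩ ⟨y, hy0, hy⟩ hadj
  obtain ⟨k, e, he, hk⟩ := cGraph_one_adj_iff.mp hadj
  replace hk : y = x + Pi.single k e := hk
  cases k using Fin.cases with
  | zero =>
    have ht : Fin.tail y = Fin.tail x := by
      ext i
      simp [hk, Fin.tail]
    have h0 : y 0 = x 0 + e := by simp [hk]
    have hp : (⟨Fin.tail y, hy⟩ : X) = ⟨Fin.tail x, hx⟩ := Subtype.ext ht
    simp only [cylinderMap, cylinderProj, hp]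
    by_cases hx1 : x 0 = 0
    · have : y 0 ≠ 0 := by omega
      simpa [hx1, this] using hfg ⟨Fin.tail x, hx⟩
    · have : y 0 = 0 := by omega
      simpa [hx1, this, SimpleGraph.adj_comm, eq_comm] using hfg ⟨Fin.tail x, hx⟩
  | succ k =>
    have h0 : y 0 = x 0 := by simp [hk]
    have ht : (c1Image X).Adj ⟨Fin.tail x, hx⟩ ⟨Fin.tail y, hy⟩ := by
      refine cGraph_one_adj_iff.mpr ⟨k, e, he, ?_⟩
      ext i
      simp [hk, Fin.tail, Pi.single_apply]
    simp only [cylinderMap, cylinderProj, h0]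
    split_ifs
    exacts [hf ht, hg ht]

namespace CubeIn

/-- The cube `{t} × Q` in the cylinder. -/
def level (t : ℤ) (ht : t = 0 ∨ t = 1) (Q : CubeIn X q) : CubeIn (cylinder X) q where
  low := Fin.cons t Q.low
  dirs := Q.dirs.map (Fin.succEmb m)
  card_dirs := by rw [Finset.card_map, Q.card_dirs]
  subset := by
    intro p hp
    have h0 := hp 0 trivial
    simp only [ElementaryCube.high, Fin.cons_zero, Set.mem_Icc] at h0
    rw [if_neg (by simp)] at h0
    refine ⟨by omega, Q.subset fun i _ => ?_⟩
    have hi := hp i.succ trivial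
    simpa [ElementaryCube.high, Fin.tail] using hi

/-- The prism `{0, 1} × Q` in the cylinder. -/
def prism (Q : CubeIn X q) : CubeIn (cylinder X) (q + 1) where
  low := Fin.cons 0 Q.low
  dirs := insert 0 (Q.dirs.map (Fin.succEmb m))
  card_dirs := by
    rw [Finset.card_insert_of_notMem (by simp), Finset.card_map, Q.card_dirs]
  subset := by
    intro p hp
    have h0 := hp 0 trivial
    simp only [ElementaryCube.high, Fin.cons_zero, Set.mem_Icc] at h0
    rw [if_pos (by simp)] at h0
    refine ⟨by omega, Q.subset fun i _ => ?_⟩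
    have hi := hp i.succ trivial
    simpa [ElementaryCube.high, Fin.tail] using hi

theorem level_dir (t : ℤ) (ht : t = 0 ∨ t = 1) (Q : CubeIn X q) (j : Fin q) :
    (Q.level t ht).dir j = (Q.dir j).succ := by
  have : (fun j => (Q.dir j).succ)
      = (Q.level t ht).dirs.orderEmbOfFin (Q.level t ht).card_dirs := by
    apply Finset.orderEmbOfFin_unique
    · intro x
      exact Finset.mem_map_of_mem (Fin.succEmb m) (Q.dir_mem x)
    · exact (Fin.strictMono_succ).comp Q.dir.strictMono
  exact (congrFun this j).symm

theorem prism_dir (Q : CubeIn X q) :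
    (Q.prism.dir : Fin (q + 1) → Fin (m + 1)) = Fin.cons 0 fun j => (Q.dir j).succ := by
  symm
  apply Finset.orderEmbOfFin_unique
  · intro x
    cases x using Fin.cases with
    | zero => exact Finset.mem_insert_self _ _
    | succ x =>
      exact Finset.mem_insert_of_mem (Finset.mem_map_of_mem (Fin.succEmb m) (Q.dir_mem x))
  · intro x y hxy
    cases y using Fin.cases with
    | zero => exact absurd hxy (Fin.not_lt_zero x)
    | succ y =>
      cases x using Fin.cases with
      | zero => simp
      | succ x => simpa using hxy

theorem prism_dir_zero (Q : CubeIn X q) : Q.prism.dir 0 = 0 := by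
  rw [prism_dir, Fin.cons_zero]

theorem prism_dir_succ (Q : CubeIn X q) (j : Fin q) : Q.prism.dir j.succ = (Q.dir j).succ := by
  rw [prism_dir, Fin.cons_succ]

theorem prism_faceA_zero (Q : CubeIn X q) : Q.prism.faceA 0 = Q.level 0 (Or.inl rfl) := by
  ext1
  · rfl
  · change (insert _ _ : Finset _).erase _ = _
    rw [prism_dir_zero, Finset.erase_insert (by simp)]
    rfl

theorem prism_faceB_zero (Q : CubeIn X q) : Q.prism.faceB 0 = Q.level 1 (Or.inr rfl) := by
  ext1
  · change Function.update _ _ _ = _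
    rw [high_dir, prism_dir_zero]
    simp [prism, level]
  · change (insert _ _ : Finset _).erase _ = _
    rw [prism_dir_zero, Finset.erase_insert (by simp)]
    rfl

theorem prism_dirs_erase (Q : CubeIn X (q + 1)) (j : Fin (q + 1)) :
    Q.prism.dirs.erase (Q.prism.dir j.succ)
      = insert 0 ((Q.dirs.erase (Q.dir j)).map (Fin.succEmb m)) := by
  rw [prism_dir_succ, Finset.map_erase]
  exact Finset.erase_insert_of_ne (Fin.succ_ne_zero _).symm

theorem prism_faceA_succ (Q : CubeIn X (q + 1)) (j : Fin (q + 1)) :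
    Q.prism.faceA j.succ = (Q.faceA j).prism := by
  ext1
  · rfl
  · exact Q.prism_dirs_erase j

theorem prism_faceB_succ (Q : CubeIn X (q + 1)) (j : Fin (q + 1)) :
    Q.prism.faceB j.succ = (Q.faceB j).prism := by
  ext1
  · change Function.update _ _ _ = Fin.cons _ (Function.update _ _ _)
    rw [high_dir, prism_dir_succ, high_dir, Fin.cons_update]
    simp [prism]
  · exact Q.prism_dirs_erase j

theorem mem_level_iff (t : ℤ) (ht : t = 0 ∨ t = 1) (Q : CubeIn X q) (p : Fin (m + 1) → ℤ) :
    p ∈ (Q.level t ht).toSet ↔ p 0 = t ∧ Fin.tail p ∈ Q.toSet := by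
  simp only [ElementaryCube.toSet, Set.mem_univ_pi, Fin.forall_fin_succ]
  apply and_congr
  · rw [Set.mem_Icc, ElementaryCube.high, if_neg (by simp [level])]
    simp only [level, Fin.cons_zero]
    omega
  · refine forall_congr' fun i => ?_
    simp [level, ElementaryCube.high, Fin.tail]

end CubeIn

/-- On the level `{t} × X` the chain map of `F` is that of the restriction of `F`. -/
theorem pushCube_level {F : cylinder X → Y} {f : X → Y} (t : ℤ) (ht : t = 0 ∨ t = 1)
    (hF : ∀ p : cylinder X, (p : Fin (m + 1) → ℤ) 0 = t → F p = f (cylinderProj p))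
    (Q : CubeIn X q) : pushCube F (Q.level t ht) = pushCube f Q := by
  have himg : imageSet F (Q.level t ht) = imageSet f Q := by
    ext y
    constructor
    · rintro ⟨p, hp, rfl⟩
      rw [CubeIn.mem_level_iff] at hp
      exact ⟨cylinderProj p, hp.2, by rw [hF p hp.1]⟩
    · rintro ⟨x, hx, rfl⟩
      refine ⟨⟨Fin.cons t x, ht, x.2⟩, (CubeIn.mem_level_iff _ _ _ _).mpr ⟨rfl, hx⟩, ?_⟩
      rw [hF _ rfl]
      rfl
  have hor : ∀ R, orientation F (Q.level t ht) R = orientation f Q R := fun R => by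
    have hc : F (Q.level t ht).corner = f Q.corner := hF _ rfl
    have hn : ∀ j, F ((Q.level t ht).neighbor j) = f (Q.neighbor j) := fun j => by
      have hpt : ((Q.level t ht).neighbor j : Fin (m + 1) → ℤ)
          = Fin.cons t (Q.neighbor j : Fin m → ℤ) := by
        simp only [CubeIn.neighbor, CubeIn.level_dir, Fin.cons_update]
        rfl
      rw [hF _ (by rw [hpt, Fin.cons_zero])]
      congr 1
      exact Subtype.ext (by simp only [cylinderProj, hpt]; rfl)
    unfold orientation
    simp only [hc, hn]
  by_cases h : ∃ R : CubeIn Y q, imageSet f Q = R.toSet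
  · obtain ⟨R, hR⟩ := h
    rw [pushCube_of_imageSet_eq hR, pushCube_of_imageSet_eq (himg.trans hR), hor]
  · rw [pushCube, pushCube, dif_neg h, dif_neg (by rwa [himg])]

/-- The prism operator. -/
noncomputable def prismChain (X : Set (Fin m → ℤ)) (q : ℕ) :
    Chain X q →ₗ[ℤ] Chain (cylinder X) (q + 1) :=
  Finsupp.linearCombination ℤ fun Q => Finsupp.single Q.prism 1

theorem prismChain_single (Q : CubeIn X q) :
    prismChain X q (Finsupp.single Q 1) = Finsupp.single Q.prism 1 := by
  simp [prismChain]

/-- Chains on the level `{t} × X`. -/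
noncomputable def levelChain (X : Set (Fin m → ℤ)) (q : ℕ) (t : ℤ) (ht : t = 0 ∨ t = 1) :
    Chain X q →ₗ[ℤ] Chain (cylinder X) q :=
  Finsupp.linearCombination ℤ fun Q => Finsupp.single (Q.level t ht) 1

theorem levelChain_single (t : ℤ) (ht : t = 0 ∨ t = 1) (Q : CubeIn X q) :
    levelChain X q t ht (Finsupp.single Q 1) = Finsupp.single (Q.level t ht) 1 := by
  simp [levelChain]

theorem pushChain_levelChain {F : cylinder X → Y} {f : X → Y} (t : ℤ) (ht : t = 0 ∨ t = 1)
    (hF : ∀ p : cylinder X, (p : Fin (m + 1) → ℤ) 0 = t → F p = f (cylinderProj p))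
    (z : Chain X q) : pushChain F q (levelChain X q t ht z) = pushChain f q z := by
  have : pushChain F q ∘ₗ levelChain X q t ht = pushChain f q := by
    refine Finsupp.lhom_ext' fun Q => LinearMap.ext_ring ?_
    simp [levelChain_single, pushChain_single, pushCube_level t ht hF]
  exact LinearMap.congr_fun this z

theorem boundary_prismChain_zero (z : Chain X 0) :
    boundary (cylinder X) 0 (prismChain X 0 z)
      = levelChain X 0 1 (Or.inr rfl) z - levelChain X 0 0 (Or.inl rfl) z := by
  have : boundary (cylinder X) 0 ∘ₗ prismChain X 0
      = levelChain X 0 1 (Or.inr rfl) - levelChain X 0 0 (Or.inl rfl) := by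
    refine Finsupp.lhom_ext' fun Q => LinearMap.ext_ring ?_
    simp only [LinearMap.comp_apply, Finsupp.lsingle_apply, LinearMap.sub_apply,
      prismChain_single, levelChain_single, boundary_single, Fin.sum_univ_succ,
      Finset.univ_eq_empty, Finset.sum_empty, add_zero, CubeIn.prism_faceA_zero,
      CubeIn.prism_faceB_zero, Fin.val_zero, zero_add, pow_one]
    module
  exact LinearMap.congr_fun this z

theorem boundary_prismChain_succ (z : Chain X (q + 1)) :
    boundary (cylinder X) (q + 1) (prismChain X (q + 1) z)
      = levelChain X (q + 1) 1 (Or.inr rfl) z - levelChain X (q + 1) 0 (Or.inl rfl) z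
        - prismChain X q (boundary X q z) := by
  have : boundary (cylinder X) (q + 1) ∘ₗ prismChain X (q + 1)
      = levelChain X (q + 1) 1 (Or.inr rfl) - levelChain X (q + 1) 0 (Or.inl rfl)
        - prismChain X q ∘ₗ boundary X q := by
    refine Finsupp.lhom_ext' fun Q => LinearMap.ext_ring ?_
    simp only [LinearMap.comp_apply, Finsupp.lsingle_apply, LinearMap.sub_apply,
      prismChain_single, levelChain_single, boundary_single, map_sum, map_smul, map_sub]
    rw [Fin.sum_univ_succ, CubeIn.prism_faceA_zero, CubeIn.prism_faceB_zero, sub_eq_add_neg _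
      (∑ _, _), ← Finset.sum_neg_distrib]
    congr 1
    · simp
    · refine Finset.sum_congr rfl fun l _ => ?_
      rw [CubeIn.prism_faceA_succ, CubeIn.prism_faceB_succ, Fin.val_succ, pow_succ _ ((l : ℕ) + 1)]
      module
  exact LinearMap.congr_fun this z

/-- Continuous maps that are pointwise adjacent or equal send a cycle to homologous cycles. -/
theorem sub_mem_boundaries_of_step {f g : X → Y} (hf : IsContinuous (c1Image X) (c1Image Y) f)
    (hg : IsContinuous (c1Image X) (c1Image Y) g)
    (hfg : ∀ x, (c1Image Y).Adj (f x) (g x) ∨ f x = g x) {z : Chain X q} (hz : z ∈ cycles X q) :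
    pushChain g q z - pushChain f q z ∈ boundaries Y q := by
  have hF := (isContinuous_cylinderMap hf hg hfg).isChainMap
  refine ⟨pushChain (cylinderMap f g) (q + 1) (prismChain X q z), ?_⟩
  rw [← LinearMap.comp_apply, ← hF q, LinearMap.comp_apply]
  have hb : boundary (cylinder X) q (prismChain X q z)
      = levelChain X q 1 (Or.inr rfl) z - levelChain X q 0 (Or.inl rfl) z := by
    cases q with
    | zero => exact boundary_prismChain_zero z
    | succ q =>
      have hz' : boundary X q z = 0 := hz
      rw [boundary_prismChain_succ, hz', map_zero, sub_zero]
  rw [hb, map_sub, pushChain_levelChain (f := g) 1, pushChain_levelChain (f := f) 0]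
  · intro p hp
    simp [cylinderMap, hp]
  · intro p hp
    simp [cylinderMap, hp]

theorem Homotopic.sub_mem_boundaries {f g : X → Y}
    (hfg : Homotopic (c1Image X) (c1Image Y) f g) {z : Chain X q} (hz : z ∈ cycles X q) :
    pushChain g q z - pushChain f q z ∈ boundaries Y q := by
  obtain ⟨-, -, k, -, H, hends, htime, hspace⟩ := hfg
  have hmem : ∀ t, t ≤ k → (t : ℤ) ∈ Set.Icc (0 : ℤ) k := fun t ht =>
    ⟨by omega, by exact_mod_cast ht⟩
  have hstep : ∀ t (ht : t ≤ k),
      pushChain (fun x => H x ⟨t, hmem t ht⟩) q z - pushChain f q z ∈ boundaries Y q := by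
    intro t
    induction t with
    | zero =>
      intro ht
      have : (fun x => H x ⟨(0 : ℕ), hmem 0 ht⟩) = f := funext fun x => (hends x).1
      rw [this, sub_self]
      exact zero_mem _
    | succ t ih =>
      intro ht
      have h := sub_mem_boundaries_of_step (hspace ⟨t, hmem t (by omega)⟩)
        (hspace ⟨(t + 1 : ℕ), hmem (t + 1) ht⟩)
        (fun x => htime x (by change |(t : ℤ) - (t + 1 : ℕ)| = 1; simp)) hz
      simpa using add_mem h (ih (by omega))
  have : (fun x => H x ⟨k, hmem k le_rfl⟩) = g := funext fun x => (hends x).2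
  rw [← this]
  exact hstep k le_rfl

theorem Homotopic.inducedMap_eq {f g : X → Y} (hfg : Homotopic (c1Image X) (c1Image Y) f g)
    (hf : IsChainMap f) (hg : IsChainMap g) (q : ℕ) : inducedMap f hf q = inducedMap g hg q := by
  refine Submodule.linearMap_qext _ (LinearMap.ext fun z => ?_)
  refine ((Submodule.Quotient.eq _).mpr ?_).symm
  exact hfg.sub_mem_boundaries z.2

end Homotopy

end DigitalImage

theorem theorem7p2 {m n : ℕ} (X : Set (Fin m → ℤ)) (Y : Set (Fin n → ℤ)) (f g : X → Y)
    (hfg : DigitalImage.Homotopic (DigitalImage.c1Image X) (DigitalImage.c1Image Y) f g) :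
    (m ≤ 3 →
      ∃ (hf : DigitalImage.IsChainMap f) (hg : DigitalImage.IsChainMap g),
        ∀ q : ℕ, DigitalImage.inducedMap f hf q = DigitalImage.inducedMap g hg q) ∧
    (DigitalImage.ChainMapConjecture →
      ∃ (hf : DigitalImage.IsChainMap f) (hg : DigitalImage.IsChainMap g),
        ∀ q : ℕ, DigitalImage.inducedMap f hf q = DigitalImage.inducedMap g hg q) := by
  have h : ∃ (hf : DigitalImage.IsChainMap f) (hg : DigitalImage.IsChainMap g),
      ∀ q : ℕ, DigitalImage.inducedMap f hf q = DigitalImage.inducedMap g hg q :=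
    ⟨hfg.1.isChainMap, hfg.2.1.isChainMap, fun q => hfg.inducedMap_eq _ _ q⟩
  exact ⟨fun _ => h, fun _ => h⟩
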